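/- Let $E,\langle\cdot,\cdot\rangle$ be a real Euclidean space spanned by a reduced irreducible (crystallographic) root system $R$ with Weyl group $W$, fix a base with positive roots $R^+$, and put $\alpha^\vee=2\alpha/\langle\alpha,\alpha\rangle$ and $\rho=\frac12\sum_{\alpha\in R^+}\alpha$. Let $\mathcal P=\{\lambda\in E\mid\langle\lambda,\alpha^\vee\rangle\in\mathbb Z\ \forall\alpha\in R\}$ and $\mathcal P^+=\{\lambda\in E\mid\langle\lambda,\alpha^\vee\rangle\in\mathbb N\ \forall\alpha\in R^+\}$, where $\mathbb N=\{0,1,2,\dots\}$, and write $\mu\preceq\lambda$ if $\lambda-\mu$ is an $\mathbb N$-linear combination of positive roots, and $\mu\prec\lambda$ if moreover $\mu\ne\lambda$. Let $q,t$ be indeterminates, of which formal real powers $q^a,t^c$ are allowed, and let $e^x$ ($x\in E$) be formal exponentials, $e^xe^y=e^{x+y}$. For $x\in E$ let $T_{x,q}$ be the linear operator with $T_{x,q}e^\lambda=q^{\langle\lambda,x\rangle}e^\lambda$. Write $W(\lambda)$ for the Weyl orbit and $W_\lambda$ for the stabilizer of $\lambda$. Put $m_\lambda=\sum_{\mu\in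 W(\lambda)}e^\mu$ and, for $\lambda\in\mathcal P$, $$\chi_\lambda=\delta^{-1}\sum_{w\in W}\det(w)\,e^{w(\lambda+\rho)},\qquad \delta=\prod_{\alpha\in R^+}(e^{\alpha/2}-e^{-\alpha/2}).$$ Let $\pi\in E$ be a minuscule weight for $R^\vee$, i.e. $\langle\pi,\alpha\rangle\in\{0,1\}$ for all $\alpha\in R^+$, and let $$D_\pi=\frac1{|W_\pi|}\sum_{w\in W}\Bigl(\prod_{\alpha\in R^+}\frac{1-t^{\langle\pi,\alpha\rangle}e^{w(\alpha)}}{1-e^{w(\alpha)}}\Bigr)T_{w(\pi),q}$$ be the associated Macdonald operator. For $\lambda\in\mathcal P$ let $w_\lambda$ be the unique shortest element of $W$ with $w_\lambda(\lambda)\in\mathcal P^+$. Then, for every $\lambda\in\mathcal P^+$, $$D_\pi m_\lambda=t^{\langle\pi,\rho\rangle}\sum_{\nu\in W(\lambda)}\Bigl(\sum_{\tau\in W(\pi)}t^{\langle\tau,\rho\rangle}q^{\langle\tau,\nu\rangle}\Bigr)\chi_\nu .$$ Moreover the set $\{\mu\in\mathcal P^+\mid\mu\prec\lambda\}$ is finite,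 and $$D_\pi m_\lambda=\epsilon_\lambda\,\chi_\lambda+\sum_{\mu\in\mathcal P^+,\ \mu\prec\lambda}b_{\lambda\mu}\,\chi_\mu,$$ where $$\epsilon_\nu=t^{\langle\pi,\rho\rangle}\sum_{\tau\in W(\pi)}t^{\langle\tau,\rho\rangle}q^{\langle\tau,\nu\rangle},\qquad b_{\lambda\mu}=\sum_{\nu\in W(\lambda)\cap(W(\mu+\rho)-\rho)}\det(w_{\rho+\nu})\,\epsilon_\nu .$$ -/

import Mathlib

/-!
# Macdonald operators of a root system, acting on symmetrized exponentials

`E` is a real Euclidean space spanned by a root system `P` (roots `P.root i ∈ E`), with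
a base `b` singling out the positive roots, and Weyl group `W = P.weylGroup` acting on `E`.
-/

noncomputable section

open scoped Classical

namespace Macdonald

/-! ## Coefficients: the indeterminates `q` and `t` and their real powers -/

/-- The ring of real linear combinations of the formal monomials `q ^ a * t ^ c`, where `a` and
`c` are real numbers: the group algebra over `ℝ` of the additive group `ℝ × ℝ`. -/
abbrev QT : Type := AddMonoidAlgebra ℝ (ℝ × ℝ)

/-- The formal power `q ^ a` of the indeterminate `q`. -/
def qPow (a : ℝ) : QT := AddMonoidAlgebra.single (a, 0) 1

/-- The formal power `t ^ c` of the indeterminate `t`. -/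
def tPow (c : ℝ) : QT := AddMonoidAlgebra.single (0, c) 1

/-! ## The algebra of exponentials -/

instance instTwoUniqueSums (E : Type*) [AddCommGroup E] [Module ℝ E] : TwoUniqueSums E :=
  letI : Module ℚ E := Module.compHom E (algebraMap ℚ ℝ)
  inferInstance

/-- The group algebra of formal exponentials `e ^ x`, `x ∈ E`, with coefficients in `QT`. It
contains the group algebra of the weight lattice (spanned by the `e ^ x` with `x` a weight) as
well as the exponentials `e ^ (α / 2)` of half roots. -/
abbrev ExpAlg (E : Type*) [AddCommGroup E] : Type _ := AddMonoidAlgebra QT E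

/-- The field of fractions of the (integral domain) `ExpAlg E`. -/
abbrev ExpField (E : Type*) [AddCommGroup E] : Type _ := FractionRing (ExpAlg E)

/-- The formal exponential `e ^ x`. -/
def exp {E : Type*} [AddCommGroup E] (x : E) : ExpAlg E := AddMonoidAlgebra.single x 1

/-- The formal exponential `e ^ x`, as an element of the field of fractions. -/
def expF {E : Type*} [AddCommGroup E] (x : E) : ExpField E :=
  algebraMap (ExpAlg E) (ExpField E) (exp x)

/-- An element of the coefficient ring, as an element of the field of fractions. -/
def coeffF (E : Type*) [AddCommGroup E] (c : QT) : ExpField E :=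
  algebraMap QT (ExpField E) c

variable {ι E N : Type*} [Fintype ι] [NormedAddCommGroup E] [InnerProductSpace ℝ E]
  [AddCommGroup N] [Module ℝ N]

/-- The `q`-translation `T_{x,q}`, the linear map (indeed algebra endomorphism) with
`T_{x,q} e ^ y = q ^ ⟨y, x⟩ e ^ y`. -/
def qTranslation (x : E) : ExpAlg E →ₐ[QT] ExpAlg E :=
  AddMonoidAlgebra.lift QT (ExpAlg E) E
    { toFun := fun y => qPow (inner ℝ y.toAdd x) • exp y.toAdd
      map_one' := by
        simp [qPow, exp, AddMonoidAlgebra.one_def, ← Prod.zero_eq_mk]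
      map_mul' := fun y z => by
        simp [qPow, exp, AddMonoidAlgebra.single_mul_single, inner_add_left] }

theorem qTranslation_exp (x y : E) :
    qTranslation x (exp y) = qPow (inner ℝ y x) • exp y := by
  simp [qTranslation, exp, AddMonoidAlgebra.lift_single]

/-! ## Euclidean root systems -/

/-- The coroots are the Euclidean ones: pairing `x` with the coroot of `α` gives
`⟨x, α^∨⟩` for the vector `α^∨ = 2 α / ⟨α, α⟩`. Equivalently, the reflections of the root system
are the orthogonal reflections `x ↦ x - ⟨x, α^∨⟩ α` of the Euclidean space `E`. -/
def IsEuclidean (P : RootPairing ι ℝ E N) : Prop :=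
  ∀ (i : ι) (x : E),
    P.toLinearMap x (P.coroot i)
      = inner ℝ x ((2 / inner ℝ (P.root i) (P.root i) : ℝ) • P.root i)

section Weyl

variable (P : RootPairing ι ℝ E N) [P.IsRootSystem]

instance instFiniteWeylGroup : Finite P.weylGroup :=
  Finite.of_injective (fun w : P.weylGroup => P.weylGroupToPerm w) <| by
    intro w w' h
    apply Subtype.ext
    apply RootPairing.Equiv.weightHom_injective P
    apply LinearEquiv.toLinearMap_injective
    refine LinearMap.ext_on_range (v := P.root) RootPairing.IsRootSystem.span_root_eq_top ?_
    intro i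
    have h1 := P.weylGroup_apply_root w i
    have h2 := P.weylGroup_apply_root w' i
    rw [show P.weylGroupToPerm w = P.weylGroupToPerm w' from h, ← h2] at h1
    exact h1

instance instFintypeWeylGroup : Fintype P.weylGroup := Fintype.ofFinite _

/-- The orbit `W(x)`. -/
def weylOrbit (x : E) : Finset E := Finset.univ.image fun w : P.weylGroup => w • x

/-- The determinant `det w` of the action of `w ∈ W` on `E` (a sign). -/
def weylDet (w : P.weylGroup) : ℝ := LinearMap.det (P.weylGroupRootRep w)

/-- The order `|W_x|` of the stabilizer of `x` in the Weyl group. -/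
def stabilizerCard (x : E) : ℕ := Nat.card (MulAction.stabilizer P.weylGroup x)

/-- The monomial symmetric function `m_x = ∑_{y ∈ W(x)} e ^ y`. -/
def monomialSymm (x : E) : ExpAlg E := ∑ y ∈ weylOrbit P x, exp y

end Weyl

section Positive

variable {P : RootPairing ι ℝ E N} (b : P.Base)

/-- The (indices of the) positive roots. -/
def posRoots : Finset ι := Finset.univ.filter fun i => b.IsPos i

/-- The half sum of the positive roots. -/
def rho : E := (1 / 2 : ℝ) • ∑ i ∈ posRoots b, P.root i

/-- The cone of dominant weights: `⟨x, α^∨⟩ ∈ ℕ` for all positive roots `α`. -/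
def Dominant (x : E) : Prop :=
  ∀ i ∈ posRoots b, ∃ n : ℕ, P.toLinearMap x (P.coroot i) = n

/-- The nonnegative semigroup `Q⁺` generated by the positive roots. -/
def posCone : AddSubmonoid E := AddSubmonoid.closure {x | ∃ i ∈ posRoots b, x = P.root i}

/-- The strict natural order `x ≺ y`: `y - x ∈ Q⁺` and `x ≠ y`. -/
def Prec (x y : E) : Prop := y - x ∈ posCone b ∧ x ≠ y

/-- The minuscule weights of the dual root system: `⟨ϖ, α⟩ ∈ {0, 1}` for all positive `α`. -/
def IsMinuscule (ϖ : E) : Prop :=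
  ∀ i ∈ posRoots b, inner ℝ ϖ (P.root i) = (0 : ℝ) ∨ inner ℝ ϖ (P.root i) = (1 : ℝ)

/-- The length of a Weyl group element: the least number of factors in a decomposition as a
product of simple reflections. -/
def weylLength (w : P.weylGroup) : ℕ :=
  sInf {n | ∃ l : List b.support,
    l.length = n ∧ (l.map fun i => RootPairing.weylGroup.ofIdx P (i : ι)).prod = w}

/-- `w` is a shortest Weyl group element such that `w(x)` is a dominant weight. -/
def IsShortestToDominant (x : E) (w : P.weylGroup) : Prop :=
  Dominant b (w • x) ∧ ∀ w' : P.weylGroup, Dominant b (w' • x) → weylLength b w ≤ weylLength b w'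

/-- The (unique) shortest Weyl group element `w_x` such that `w_x(x)` is dominant, for a
weight `x`. -/
def shortestToDominant (x : E) : P.weylGroup := Classical.epsilon (IsShortestToDominant b x)

/-- The Weyl denominator `δ = ∏_{α > 0} (e ^ (α / 2) - e ^ (- α / 2))`. -/
def weylDenominator : ExpField E :=
  ∏ i ∈ posRoots b, (expF ((1 / 2 : ℝ) • P.root i) - expF (-((1 / 2 : ℝ) • P.root i)))

variable [P.IsRootSystem]

/-- The Weyl character `χ_x = δ⁻¹ ∑_{w ∈ W} det(w) e ^ (w(x + ρ))`, for any weight `x`. -/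
def weylChar (x : E) : ExpField E :=
  (weylDenominator b)⁻¹ * ∑ w : P.weylGroup, weylDet P w • expF (w • (x + rho b))

/-- The coefficient `∏_{α > 0} (1 - t ^ ⟨ϖ, α⟩ e ^ (w α)) / (1 - e ^ (w α))`. -/
def macdonaldCoeff (ϖ : E) (w : P.weylGroup) : ExpField E :=
  ∏ i ∈ posRoots b,
    (1 - coeffF E (tPow (inner ℝ ϖ (P.root i))) * expF (w • P.root i)) /
      (1 - expF (w • P.root i))

/-- The Macdonald operator
`D_ϖ = |W_ϖ|⁻¹ ∑_{w ∈ W} (∏_{α > 0} (1 - t ^ ⟨ϖ, α⟩ e ^ (w α)) / (1 - e ^ (w α))) T_{w ϖ, q}`,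
a linear map into the field of fractions, as its coefficients are fractions. -/
def macdonaldOp (ϖ : E) : ExpAlg E →ₗ[QT] ExpField E :=
  (stabilizerCard P ϖ : ExpField E)⁻¹ • ∑ w : P.weylGroup,
    macdonaldCoeff b ϖ w •
      ((Algebra.linearMap (ExpAlg E) (ExpField E)).restrictScalars QT ∘ₗ
        (qTranslation (w • ϖ)).toLinearMap)

/-- `ε_x = t ^ ⟨ϖ, ρ⟩ ∑_{τ ∈ W(ϖ)} t ^ ⟨τ, ρ⟩ q ^ ⟨τ, x⟩`. -/
def eigenvalue (ϖ x : E) : QT :=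
  tPow (inner ℝ ϖ (rho b)) *
    ∑ τ ∈ weylOrbit P ϖ, tPow (inner ℝ τ (rho b)) * qPow (inner ℝ τ x)

/-- `b_{x y} = ∑ det(w_{ρ + ν}) ε_ν`, the sum being over `ν ∈ W(x) ∩ (W(y + ρ) - ρ)`. -/
def matrixCoeff (ϖ x y : E) : QT :=
  ∑ ν ∈ weylOrbit P x ∩ (weylOrbit P (y + rho b)).image (fun z => z - rho b),
    weylDet P (shortestToDominant b (rho b + ν)) • eigenvalue b ϖ ν

end Positive

end Macdonald

end

noncomputable section

open scoped Classical

namespace Macdonald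

open RootPairing

section

variable {ι E N : Type*} [NormedAddCommGroup E] [InnerProductSpace ℝ E]
  [AddCommGroup N] [Module ℝ N]

/-! ## The action of the Weyl group on roots and weights -/

section Action

variable (P : RootPairing ι ℝ E N)

/-! Let δ be the Weyl denominator and T_{ϖ,t} the `t`-analogue of the `q`-translation
(`tTranslation`). After splitting α into two halves, each factor (1 - t^⟨ϖ,α⟩ e^{wα}) / (1 - e^{wα})
is t^{⟨ϖ,α⟩/2} times the ratio of w T_{ϖ,t}(e^{α/2} - e^{-α/2}) to w(e^{α/2} - e^{-α/2}). Since wδ =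
det(w) δ, the whole coefficient equals t^⟨ϖ,ρ⟩ det(w) δ⁻¹ w(T_{ϖ,t} δ) (`macdonaldCoeff_mul`). The
Weyl denominator formula (`denominator_eq_altSum`) turns det(w) w(T_{ϖ,t} δ) into ∑_v det(v)
t^⟨vρ,wϖ⟩ e^{vρ}. In the product with T_{wϖ,q} m_λ, replace w by vw and ν by vν: invariance of the
inner product removes v from all powers of q and t, and the sum over v becomes the numerator of χ_ν
(`sum_weylAct_mul_qTranslation`).

The triangular form comes from straightening: χ_ν = det(w) χ_{w(ρ+ν)-ρ}, with w chosen so that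
w(ρ+ν) is dominant. If a simple reflection fixes w(ρ+ν), antisymmetry gives χ_ν = 0; otherwise
w(ρ+ν) = μ+ρ with μ dominant. For ν = uλ, the difference λ-μ = (λ - wuλ) + (ρ - wρ) is a sum of two
elements of the positive cone and vanishes only if w = 1 and ν = λ. So every ν ≠ λ contributes to at
most one μ, and μ ≺ λ (`prec_smul_add_rho_sub_rho`, `weylChar_eq_sum`).

The facts about chambers rest on `weylGroup_induction`, which passes from w s_i to w when w α_i is
negative. -/

theorem ofIdx_smul_eq (i : ι) (x : E) :
    weylGroup.ofIdx P i • x = x - P.toLinearMap x (P.coroot i) • P.root i := by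
  rw [weylGroup.ofIdx_smul, Equiv.reflection_smul, reflection_apply]
  rfl

theorem ofIdx_smul_root (i : ι) : weylGroup.ofIdx P i • P.root i = -P.root i := by
  rw [ofIdx_smul_eq, root_coroot_two]
  module

theorem weylGroup_ext {w w' : P.weylGroup} (h : ∀ x : E, w • x = w' • x) : w = w' :=
  Subtype.ext <| Equiv.weightHom_injective P <| LinearEquiv.ext h

theorem weyl_smul_smul (w : P.weylGroup) (c : ℝ) (x : E) : w • c • x = c • w • x :=
  smul_comm w c x

theorem ofIdx_mul_self (i : ι) : weylGroup.ofIdx P i * weylGroup.ofIdx P i = 1 := by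
  refine weylGroup_ext P fun x => ?_
  rw [mul_smul, ofIdx_smul_eq P i x, smul_sub, weyl_smul_smul, ofIdx_smul_root, ofIdx_smul_eq,
    one_smul]
  module

theorem weylGroupToPerm_ofIdx (i j : ι) :
    P.weylGroupToPerm (weylGroup.ofIdx P i) j = P.reflectionPerm i j := rfl

variable {P}

theorem IsEuclidean.pairing_eq (hP : IsEuclidean P) (x : E) (i : ι) :
    P.toLinearMap x (P.coroot i)
      = 2 / inner ℝ (P.root i) (P.root i) * inner ℝ x (P.root i) := by
  rw [hP, inner_smul_right]

theorem inner_root_self_pos (i : ι) : (0 : ℝ) < inner ℝ (P.root i) (P.root i) :=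
  real_inner_self_pos.mpr (P.ne_zero i)

theorem IsEuclidean.pairing_nonneg_iff (hP : IsEuclidean P) (x : E) (i : ι) :
    0 ≤ P.toLinearMap x (P.coroot i) ↔ (0 : ℝ) ≤ inner ℝ x (P.root i) := by
  have := inner_root_self_pos (P := P) i
  rw [hP.pairing_eq, mul_nonneg_iff_of_pos_left (by positivity)]

theorem IsEuclidean.inner_eq (hP : IsEuclidean P) (x : E) (i : ι) :
    inner ℝ x (P.root i)
      = P.toLinearMap x (P.coroot i) * (inner ℝ (P.root i) (P.root i) / 2) := by
  have := inner_root_self_pos (P := P) i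
  rw [hP.pairing_eq]
  field_simp

theorem IsEuclidean.inner_smul_smul (hP : IsEuclidean P) (w : P.weylGroup) (x y : E) :
    inner ℝ (w • x) (w • y) = (inner ℝ x y : ℝ) := by
  revert x y
  obtain ⟨w, hw⟩ := w
  induction hw using weylGroup.induction with
  | mem i =>
    intro x y
    change inner ℝ (weylGroup.ofIdx P i • x) (weylGroup.ofIdx P i • y) = (inner ℝ x y : ℝ)
    rw [ofIdx_smul_eq, ofIdx_smul_eq]
    simp only [inner_sub_left, inner_sub_right, real_inner_smul_left, real_inner_smul_right]
    rw [real_inner_comm y (P.root i), hP.inner_eq x i, hP.inner_eq y i]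
    ring
  | one => exact fun x y => rfl
  | mul g₁ g₂ hg₁ hg₂ h₁ h₂ =>
    intro x y
    rw [← Submonoid.mk_mul_mk _ _ _ hg₁ hg₂, mul_smul, mul_smul, h₁, h₂]

theorem IsEuclidean.pairing_smul_smul (hP : IsEuclidean P) (w : P.weylGroup) (x : E) (i : ι) :
    P.toLinearMap (w • x) (P.coroot (P.weylGroupToPerm w i))
      = P.toLinearMap x (P.coroot i) := by
  rw [hP.pairing_eq, hP.pairing_eq, ← P.weylGroup_apply_root, hP.inner_smul_smul,
    hP.inner_smul_smul]

theorem mul_ofIdx_eq (hP : IsEuclidean P) {w : P.weylGroup} {i k : ι}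
    (h : w • P.root i = P.root k) :
    weylGroup.ofIdx P k * w = w * weylGroup.ofIdx P i := by
  have hk : P.weylGroupToPerm w i = k :=
    P.root.injective (by rw [← P.weylGroup_apply_root, h])
  refine weylGroup_ext P fun x => ?_
  rw [mul_smul, mul_smul, ofIdx_smul_eq, ofIdx_smul_eq, smul_sub, weyl_smul_smul, h, ← hk,
    hP.pairing_smul_smul]

end Action

/-! ## Simple reflections and positive roots -/

section Simple

variable {P : RootPairing ι ℝ E N} (b : P.Base)

/-- The product of a word in the simple reflections. -/
def wordProd (l : List b.support) : P.weylGroup :=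
  (l.map fun i => weylGroup.ofIdx P (i : ι)).prod

@[simp] theorem wordProd_nil : wordProd b [] = 1 := rfl

@[simp] theorem wordProd_cons (i : b.support) (l : List b.support) :
    wordProd b (i :: l) = weylGroup.ofIdx P (i : ι) * wordProd b l := by
  simp [wordProd]

@[simp] theorem wordProd_append (l l' : List b.support) :
    wordProd b (l ++ l') = wordProd b l * wordProd b l' := by
  simp [wordProd]

variable {b}

theorem exists_pos_neg_of_not_isPos {i : ι} (hi : ¬ b.IsPos i) :
    ∃ k, b.IsPos k ∧ P.root k = -P.root i := by
  let := P.indexNeg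
  exact ⟨-i, (Base.IsPos.neg_iff_not b i).mpr hi, by simp⟩

theorem not_isPos_of_root_eq_neg {i k : ι} (hk : b.IsPos k) (h : P.root k = -P.root i) :
    ¬ b.IsPos i := by
  let := P.indexNeg
  have : k = -i := P.root.injective (by simp [h])
  exact (Base.IsPos.neg_iff_not b i).mp (this ▸ hk)

variable [Fintype ι]

theorem mem_posRoots {i : ι} : i ∈ posRoots b ↔ b.IsPos i := by simp [posRoots]

variable [P.IsCrystallographic] [P.IsReduced]

theorem exists_wordProd_ofIdx (hP : IsEuclidean P) (i : ι) :
    ∃ l, wordProd b l = weylGroup.ofIdx P i := by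
  have key : ∀ i, b.IsPos i → ∃ l, wordProd b l = weylGroup.ofIdx P i := by
    intro i hi
    refine hi.induction_on_reflect (p := fun i => ∃ l, wordProd b l = weylGroup.ofIdx P i)
      (fun j hj => ⟨[⟨j, hj⟩], by simp⟩) ?_
    rintro i j ⟨l, hl⟩ hj
    refine ⟨⟨j, hj⟩ :: l ++ [⟨j, hj⟩], ?_⟩
    have h := mul_ofIdx_eq hP (w := weylGroup.ofIdx P j) (i := i) (k := P.reflectionPerm j i)
      (P.weylGroup_apply_root _ _)
    simp only [wordProd_append, wordProd_cons, wordProd_nil, hl, mul_one, ← h, mul_assoc,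
      ofIdx_mul_self]
  by_cases hi : b.IsPos i
  · exact key i hi
  obtain ⟨k, hk, h⟩ := exists_pos_neg_of_not_isPos hi
  obtain ⟨l, hl⟩ := key k hk
  refine ⟨l, hl.trans (weylGroup_ext P fun x => ?_)⟩
  rw [ofIdx_smul_eq, ofIdx_smul_eq, hP.pairing_eq, hP.pairing_eq, h]
  simp

theorem exists_wordProd (hP : IsEuclidean P) (w : P.weylGroup) : ∃ l, wordProd b l = w := by
  obtain ⟨w, hw⟩ := w
  induction hw using weylGroup.induction with
  | mem i => exact exists_wordProd_ofIdx hP i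
  | one => exact ⟨[], rfl⟩
  | mul g₁ g₂ hg₁ hg₂ h₁ h₂ =>
    obtain ⟨l₁, h₁⟩ := h₁
    obtain ⟨l₂, h₂⟩ := h₂
    exact ⟨l₁ ++ l₂, by rw [wordProd_append, h₁, h₂]; rfl⟩

/-- Applying the letters from the right, α_i starts positive and ends negative. A simple reflection
s_k makes no positive root negative except α_k, so at a letter where the sign flips the current root
u α_i is α_k. There s_k u = u s_i, and this letter can be deleted. -/
theorem exchange (hP : IsEuclidean P) (i : b.support) (l : List b.support)
    (h : ¬ b.IsPos (P.weylGroupToPerm (wordProd b l) i)) :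
    ∃ l', l'.length + 1 = l.length ∧
      wordProd b l' = wordProd b l * weylGroup.ofIdx P (i : ι) := by
  induction l with
  | nil => exact absurd (Base.isPos_of_mem_support i.2) (by simpa using h)
  | cons k l ih =>
    by_cases hl : b.IsPos (P.weylGroupToPerm (wordProd b l) i)
    · have hk : P.weylGroupToPerm (wordProd b l) i = k := by
        by_contra hne
        refine h ?_
        rw [wordProd_cons, map_mul, Equiv.Perm.mul_apply, weylGroupToPerm_ofIdx]
        exact hl.reflectionPerm k.2 hne
      refine ⟨l, by simp, ?_⟩
      have := mul_ofIdx_eq hP (w := wordProd b l) (i := i) (k := k)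
        (by rw [P.weylGroup_apply_root, hk])
      rw [wordProd_cons, this, mul_assoc, ofIdx_mul_self, mul_one]
    · obtain ⟨l', hl', h'⟩ := ih hl
      exact ⟨k :: l', by simp [hl'], by rw [wordProd_cons, wordProd_cons, h', mul_assoc]⟩

/-- Induction over the Weyl group, along right multiplications by simple reflections which
decrease the length. -/
theorem weylGroup_induction (hP : IsEuclidean P) {p : P.weylGroup → Prop} (one : p 1)
    (step : ∀ (w : P.weylGroup) (i : b.support), ¬ b.IsPos (P.weylGroupToPerm w i) →
      p (w * weylGroup.ofIdx P (i : ι)) → p w) (w : P.weylGroup) : p w := by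
  have key : ∀ (n : ℕ) (l : List b.support), l.length ≤ n → p (wordProd b l) := by
    intro n
    induction n with
    | zero =>
      intro l hl
      rw [List.eq_nil_of_length_eq_zero (Nat.le_zero.mp hl)]
      exact one
    | succ n ih =>
      intro l hl
      rcases List.eq_nil_or_concat' l with rfl | ⟨l', i, rfl⟩
      · exact one
      have hl' : l'.length ≤ n := by simpa using hl
      have hw : wordProd b (l' ++ [i]) = wordProd b l' * weylGroup.ofIdx P (i : ι) := by simp
      rw [hw]
      -- Write w' for the product of `l'`. If w' α_i is positive, then (w' s_i) α_i is negative and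
      -- `step` applies; otherwise w' s_i has a word even shorter than `l'`.
      by_cases hpos : b.IsPos (P.weylGroupToPerm (wordProd b l') i)
      · refine step _ i ?_ (by rw [mul_assoc, ofIdx_mul_self, mul_one]; exact ih l' hl')
        refine not_isPos_of_root_eq_neg hpos ?_
        rw [← P.weylGroup_apply_root, ← P.weylGroup_apply_root, mul_smul, ofIdx_smul_root,
          smul_neg, neg_neg]
      · obtain ⟨l'', hlen, h''⟩ := exchange hP i l' hpos
        rw [← h'']
        exact ih l'' (by omega)
  obtain ⟨l, rfl⟩ := exists_wordProd (b := b) hP w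
  exact key _ l le_rfl

end Simple

end

section

variable {ι E N : Type*} [Fintype ι] [NormedAddCommGroup E] [InnerProductSpace ℝ E]
  [AddCommGroup N] [Module ℝ N]

/-! ## Weights, the half sum of the positive roots and the positive cone -/

section Weights

variable (P : RootPairing ι ℝ E N)

/-- The weights: `⟨x, α^∨⟩ ∈ ℤ` for all roots `α`. -/
def IsWeight (x : E) : Prop := ∀ i, ∃ z : ℤ, P.toLinearMap x (P.coroot i) = z

variable {P} {b : P.Base}

omit [Fintype ι] in
theorem IsWeight.add {x y : E} (hx : IsWeight P x) (hy : IsWeight P y) : IsWeight P (x + y) := by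
  intro i
  obtain ⟨m, hm⟩ := hx i
  obtain ⟨n, hn⟩ := hy i
  exact ⟨m + n, by rw [map_add, LinearMap.add_apply, hm, hn]; push_cast; rfl⟩

omit [Fintype ι] in
theorem IsWeight.sub {x y : E} (hx : IsWeight P x) (hy : IsWeight P y) : IsWeight P (x - y) := by
  intro i
  obtain ⟨m, hm⟩ := hx i
  obtain ⟨n, hn⟩ := hy i
  exact ⟨m - n, by rw [map_sub, LinearMap.sub_apply, hm, hn]; push_cast; rfl⟩

omit [Fintype ι] in
theorem isWeight_root [P.IsCrystallographic] (i : ι) : IsWeight P (P.root i) := fun j =>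
  ⟨P.pairingIn ℤ i j, by
    rw [root_coroot_eq_pairing, ← P.algebraMap_pairingIn ℤ]
    rfl⟩

omit [Fintype ι] in
theorem IsWeight.smul (hP : IsEuclidean P) {x : E} (hx : IsWeight P x) (w : P.weylGroup) :
    IsWeight P (w • x) := by
  intro i
  obtain ⟨z, hz⟩ := hx ((P.weylGroupToPerm w).symm i)
  exact ⟨z, by rw [← hz, ← hP.pairing_smul_smul w x, Equiv.apply_symm_apply]⟩

theorem Dominant.isWeight (hP : IsEuclidean P) {x : E} (hx : Dominant b x) : IsWeight P x := by
  intro i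
  by_cases hi : b.IsPos i
  · obtain ⟨n, hn⟩ := hx i (mem_posRoots.mpr hi)
    exact ⟨n, by simpa using hn⟩
  · obtain ⟨k, hk, h⟩ := exists_pos_neg_of_not_isPos hi
    obtain ⟨n, hn⟩ := hx k (mem_posRoots.mpr hk)
    refine ⟨-n, ?_⟩
    rw [hP.pairing_eq, h] at hn
    rw [hP.pairing_eq]
    simp only [inner_neg_left, inner_neg_right, neg_neg] at hn
    push_cast
    linarith

theorem Dominant.inner_nonneg (hP : IsEuclidean P) {x : E} (hx : Dominant b x) {i : ι}
    (hi : b.IsPos i) : (0 : ℝ) ≤ inner ℝ x (P.root i) := by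
  obtain ⟨n, hn⟩ := hx i (mem_posRoots.mpr hi)
  rw [← hP.pairing_nonneg_iff, hn]
  positivity

theorem Dominant.add {x y : E} (hx : Dominant b x) (hy : Dominant b y) : Dominant b (x + y) := by
  intro i hi
  obtain ⟨m, hm⟩ := hx i hi
  obtain ⟨n, hn⟩ := hy i hi
  exact ⟨m + n, by rw [map_add, LinearMap.add_apply, hm, hn]; push_cast; rfl⟩

variable [P.IsCrystallographic]

theorem dominant_of_simple (hP : IsEuclidean P) {x : E} (hx : IsWeight P x)
    (h : ∀ i ∈ b.support, 0 ≤ P.toLinearMap x (P.coroot i)) : Dominant b x := by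
  intro i hi
  have hpos : (0 : ℝ) ≤ inner ℝ x (P.root i) := by
    refine (mem_posRoots.mp hi).induction_on_add (p := fun i => (0 : ℝ) ≤ inner ℝ x (P.root i))
      (fun j hj => (hP.pairing_nonneg_iff x j).mp (h j hj)) ?_
    intro i j k hk hi hj
    rw [hk, inner_add_right]
    exact add_nonneg hi ((hP.pairing_nonneg_iff x j).mp (h j hj))
  obtain ⟨z, hz⟩ := hx i
  rw [← hP.pairing_nonneg_iff, hz] at hpos
  lift z to ℕ using by exact_mod_cast hpos
  exact ⟨z, by simpa using hz⟩

variable [P.IsReduced]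

/-- A simple reflection permutes the positive roots other than the simple root. -/
theorem prod_posRoots_erase_reflectionPerm {M : Type*} [CommMonoid M] (f : ι → M) {i : ι}
    (hi : i ∈ b.support) :
    ∏ j ∈ (posRoots b).erase i, f (P.weylGroupToPerm (weylGroup.ofIdx P i) j)
      = ∏ j ∈ (posRoots b).erase i, f j := by
  have hmem : ∀ j ∈ (posRoots b).erase i, P.reflectionPerm i j ∈ (posRoots b).erase i := by
    intro j hj
    obtain ⟨hji, hj⟩ := Finset.mem_erase.mp hj
    refine Finset.mem_erase.mpr ⟨fun h => ?_,
      mem_posRoots.mpr ((mem_posRoots.mp hj).reflectionPerm hi hji)⟩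
    refine not_isPos_of_root_eq_neg (P := P) (mem_posRoots.mp hj) (i := i) ?_
      (Base.isPos_of_mem_support hi)
    have h' := congrArg P.root h
    rw [root_reflectionPerm] at h'
    rw [← P.reflection_apply_self i, ← h', reflection_same]
  refine Finset.prod_bij' (fun j _ => P.reflectionPerm i j) (fun j _ => P.reflectionPerm i j)
    hmem hmem ?_ ?_ ?_
  · intro j _
    simp
  · intro j _
    simp
  · intro j _
    rfl

theorem sum_posRoots_erase_reflectionPerm {M : Type*} [AddCommMonoid M] (f : ι → M) {i : ι}
    (hi : i ∈ b.support) :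
    ∑ j ∈ (posRoots b).erase i, f (P.weylGroupToPerm (weylGroup.ofIdx P i) j)
      = ∑ j ∈ (posRoots b).erase i, f j :=
  prod_posRoots_erase_reflectionPerm (M := Multiplicative M) f hi

theorem ofIdx_smul_rho {i : ι} (hi : i ∈ b.support) :
    weylGroup.ofIdx P i • rho b = rho b - P.root i := by
  have hmem : i ∈ posRoots b := mem_posRoots.mpr (Base.isPos_of_mem_support hi)
  have h := sum_posRoots_erase_reflectionPerm (b := b) P.root hi
  rw [rho, weyl_smul_smul, ← Finset.add_sum_erase _ _ hmem, smul_add, ofIdx_smul_root,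
    Finset.smul_sum]
  simp_rw [P.weylGroup_apply_root]
  rw [h]
  module

theorem pairing_rho_simple {i : ι} (hi : i ∈ b.support) :
    P.toLinearMap (rho b) (P.coroot i) = 1 := by
  have h := ofIdx_smul_rho (b := b) hi
  rw [ofIdx_smul_eq, sub_right_inj] at h
  exact smul_left_injective ℝ (P.ne_zero i) (by simpa using h)

theorem isWeight_rho (hP : IsEuclidean P) : IsWeight P (rho b) := by
  intro i
  have key : ∀ i, b.IsPos i → ∃ z : ℤ, P.toLinearMap (rho b) (P.coroot i) = z := by
    intro i hi
    refine hi.induction_on_reflect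
      (p := fun i => ∃ z : ℤ, P.toLinearMap (rho b) (P.coroot i) = z)
      (fun j hj => ⟨1, by simpa using pairing_rho_simple hj⟩) ?_
    rintro i j ⟨z, hz⟩ hj
    obtain ⟨z', hz'⟩ := isWeight_root (P := P) j i
    refine ⟨z - z', ?_⟩
    -- As s_j ρ = ρ - α_j, the pairing of ρ with the coroot of s_j α_i is that of ρ - α_j with the
    -- coroot of α_i.
    have h := hP.pairing_smul_smul (weylGroup.ofIdx P j) (weylGroup.ofIdx P j • rho b) i
    rw [← mul_smul, ofIdx_mul_self, one_smul, weylGroupToPerm_ofIdx, ofIdx_smul_rho hj, map_sub,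
      LinearMap.sub_apply, hz, hz'] at h
    rw [h]
    push_cast
    rfl
  by_cases hi : b.IsPos i
  · exact key i hi
  · obtain ⟨k, hk, h⟩ := exists_pos_neg_of_not_isPos hi
    obtain ⟨z, hz⟩ := key k hk
    refine ⟨-z, ?_⟩
    rw [hP.pairing_eq, h] at hz
    rw [hP.pairing_eq]
    simp only [inner_neg_left, inner_neg_right, neg_neg] at hz
    push_cast
    linarith

theorem dominant_rho (hP : IsEuclidean P) : Dominant b (rho b) :=
  dominant_of_simple hP (isWeight_rho hP) fun i hi => by
    rw [pairing_rho_simple hi]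
    exact zero_le_one

theorem inner_rho_root_pos (hP : IsEuclidean P) {i : ι} (hi : b.IsPos i) :
    (0 : ℝ) < inner ℝ (rho b) (P.root i) := by
  have simple : ∀ j ∈ b.support, (0 : ℝ) < inner ℝ (rho b) (P.root j) := fun j hj => by
    have := inner_root_self_pos (P := P) j
    rw [hP.inner_eq, pairing_rho_simple hj]
    positivity
  refine hi.induction_on_add (p := fun i => (0 : ℝ) < inner ℝ (rho b) (P.root i)) simple ?_
  intro i j k hk hi hj
  rw [hk, inner_add_right]
  exact add_pos hi (simple j hj)

omit [P.IsCrystallographic] [P.IsReduced] in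
theorem root_mem_posCone {i : ι} (hi : b.IsPos i) : P.root i ∈ posCone b :=
  AddSubmonoid.subset_closure ⟨i, mem_posRoots.mpr hi, rfl⟩

omit [P.IsCrystallographic] [P.IsReduced] in
theorem inner_nonneg_of_mem_posCone {x z : E}
    (hx : ∀ i, b.IsPos i → (0 : ℝ) ≤ inner ℝ x (P.root i)) (hz : z ∈ posCone b) :
    (0 : ℝ) ≤ inner ℝ x z := by
  induction hz using AddSubmonoid.closure_induction with
  | mem z hz =>
    obtain ⟨i, hi, rfl⟩ := hz
    exact hx i (mem_posRoots.mp hi)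
  | zero => simp
  | add y z _ _ hy hz =>
    rw [inner_add_right]
    exact add_nonneg hy hz

/-- The cone is pointed because ρ pairs strictly positively with its generators; this is the source
of strictness in the order. -/
theorem eq_zero_or_inner_rho_pos (hP : IsEuclidean P) {z : E} (hz : z ∈ posCone b) :
    z = 0 ∨ (0 : ℝ) < inner ℝ (rho b) z := by
  induction hz using AddSubmonoid.closure_induction with
  | mem z hz =>
    obtain ⟨i, hi, rfl⟩ := hz
    exact Or.inr (inner_rho_root_pos hP (mem_posRoots.mp hi))
  | zero => exact Or.inl rfl
  | add y z _ _ hy hz =>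
    rcases hy with rfl | hy
    · simpa using hz
    · rcases hz with rfl | hz
      · simpa using Or.inr hy
      · exact Or.inr (by rw [inner_add_right]; exact add_pos hy hz)

theorem eq_zero_of_add_eq_zero (hP : IsEuclidean P) {y z : E} (hy : y ∈ posCone b)
    (hz : z ∈ posCone b) (h : y + z = 0) : y = 0 ∧ z = 0 := by
  have hsum : (inner ℝ (rho b) y : ℝ) + inner ℝ (rho b) z = 0 := by
    rw [← inner_add_right, h, inner_zero_right]
  rcases eq_zero_or_inner_rho_pos hP hy with rfl | hy'
  · exact ⟨rfl, by simpa using h⟩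
  · rcases eq_zero_or_inner_rho_pos hP hz with rfl | hz'
    · exact ⟨by simpa using h, rfl⟩
    · linarith

omit [P.IsCrystallographic] [P.IsReduced] in
theorem exists_sum_of_mem_posCone {z : E} (hz : z ∈ posCone b) :
    ∃ n : ι → ℕ, z = ∑ i ∈ posRoots b, n i • P.root i := by
  induction hz using AddSubmonoid.closure_induction with
  | mem z hz =>
    obtain ⟨i, hi, rfl⟩ := hz
    refine ⟨Pi.single i 1, ?_⟩
    rw [Finset.sum_eq_single_of_mem i hi fun j _ hj => by simp [hj]]
    simp
  | zero => exact ⟨0, by simp⟩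
  | add y z _ _ hy hz =>
    obtain ⟨m, rfl⟩ := hy
    obtain ⟨n, rfl⟩ := hz
    exact ⟨m + n, by simp [add_smul, Finset.sum_add_distrib]⟩

/-- A bound on the pairing with ρ bounds the multiplicity of each positive root separately. -/
theorem finite_posCone_inner_le (hP : IsEuclidean P) (c : ℝ) :
    {z : E | z ∈ posCone b ∧ (inner ℝ (rho b) z : ℝ) ≤ c}.Finite := by
  let bound : ι → ℕ := fun i => ⌊c / inner ℝ (rho b) (P.root i)⌋₊
  refine ((Set.finite_Iic bound).image
    fun n => ∑ i ∈ posRoots b, n i • P.root i).subset ?_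
  rintro z ⟨hz, hc⟩
  obtain ⟨n, rfl⟩ := exists_sum_of_mem_posCone hz
  -- Multiplicities off the positive roots are arbitrary, so they are set to 0 to stay inside the
  -- finite box.
  refine ⟨fun i => if i ∈ posRoots b then n i else 0, fun i => ?_,
    Finset.sum_congr rfl fun i hi => by simp [hi]⟩
  by_cases hi : i ∈ posRoots b
  · have hpos := inner_rho_root_pos hP (mem_posRoots.mp hi)
    simp only [hi, if_true, bound]
    refine Nat.le_floor ((le_div_iff₀ hpos).mpr (le_trans ?_ hc))
    rw [inner_sum]
    simp_rw [← Nat.cast_smul_eq_nsmul ℝ, real_inner_smul_right]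
    exact Finset.single_le_sum (f := fun i => (n i : ℝ) * inner ℝ (rho b) (P.root i))
      (fun j hj => mul_nonneg (Nat.cast_nonneg _)
        (inner_rho_root_pos hP (mem_posRoots.mp hj)).le) hi
  · simp [hi]

theorem finite_dominant_prec (hP : IsEuclidean P) (x : E) :
    {y : E | Dominant b y ∧ Prec b y x}.Finite := by
  refine ((finite_posCone_inner_le (b := b) hP (inner ℝ (rho b) x)).image
    fun z => x - z).subset ?_
  rintro y ⟨hy, hyx, -⟩
  refine ⟨x - y, ⟨hyx, ?_⟩, sub_sub_cancel x y⟩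
  have h : (0 : ℝ) ≤ inner ℝ (rho b) y := by
    rw [rho, real_inner_smul_left, sum_inner]
    refine mul_nonneg (by norm_num) (Finset.sum_nonneg fun i hi => ?_)
    rw [real_inner_comm]
    exact hy.inner_nonneg hP (mem_posRoots.mp hi)
  rw [inner_sub_right]
  linarith

end Weights

/-! ## Dominant representatives of the orbits -/

section Orbits

variable {P : RootPairing ι ℝ E N} {b : P.Base} [P.IsCrystallographic] [P.IsReduced]

/-- When w α_i is negative, x - wx exceeds x - w s_i x by ⟨x, α_i^∨⟩ copies of the positive root -w
α_i. -/
theorem Dominant.sub_smul_mem_posCone (hP : IsEuclidean P) {x : E} (hx : Dominant b x)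
    (w : P.weylGroup) : x - w • x ∈ posCone b := by
  induction w using weylGroup_induction (b := b) hP with
  | one => simp [zero_mem]
  | step w i hw ih =>
    obtain ⟨k, hk, h⟩ := exists_pos_neg_of_not_isPos hw
    obtain ⟨n, hn⟩ := hx i (mem_posRoots.mpr (Base.isPos_of_mem_support i.2))
    have hxw : x - w • x = (x - (w * weylGroup.ofIdx P (i : ι)) • x) + n • P.root k := by
      rw [mul_smul, ofIdx_smul_eq, smul_sub, weyl_smul_smul, hn, h, P.weylGroup_apply_root,
        Nat.cast_smul_eq_nsmul, smul_neg]
      abel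
    rw [hxw]
    exact add_mem ih (nsmul_mem (root_mem_posCone hk) n)

/-- If w α_i is negative, ⟨x, α_i⟩ = ⟨wx, w α_i⟩ is both nonnegative and nonpositive. Hence s_i
fixes x, and w may be replaced by w s_i. -/
theorem smul_eq_self_of_nonneg (hP : IsEuclidean P) {x : E} (w : P.weylGroup)
    (hx : ∀ i, b.IsPos i → (0 : ℝ) ≤ inner ℝ x (P.root i))
    (hwx : ∀ i, b.IsPos i → (0 : ℝ) ≤ inner ℝ (w • x) (P.root i)) : w • x = x := by
  induction w using weylGroup_induction (b := b) hP with
  | one => exact one_smul _ x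
  | step w i hw ih =>
    obtain ⟨k, hk, h⟩ := exists_pos_neg_of_not_isPos hw
    have h1 := hx i (Base.isPos_of_mem_support i.2)
    have h2 := hwx k hk
    rw [h, ← P.weylGroup_apply_root, inner_neg_right, hP.inner_smul_smul] at h2
    have h0 : (inner ℝ x (P.root i) : ℝ) = 0 := by linarith
    have hs : (w * weylGroup.ofIdx P (i : ι)) • x = w • x := by
      rw [mul_smul, ofIdx_smul_eq, hP.pairing_eq, h0]
      simp
    rw [hs] at ih
    exact ih hwx

/-- The same comparison of signs, now strict, is a contradiction as soon as w makes some simple root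
negative. -/
theorem eq_one_of_smul_eq (hP : IsEuclidean P) {x : E} {w : P.weylGroup}
    (hx : ∀ i, b.IsPos i → (0 : ℝ) < inner ℝ x (P.root i)) (h : w • x = x) : w = 1 := by
  induction w using weylGroup_induction (b := b) hP with
  | one => rfl
  | step w i hw ih =>
    obtain ⟨k, hk, hk'⟩ := exists_pos_neg_of_not_isPos hw
    have h1 := hx i (Base.isPos_of_mem_support i.2)
    have h2 := hx k hk
    rw [hk', ← P.weylGroup_apply_root, inner_neg_right] at h2
    rw [← hP.inner_smul_smul w, h] at h1
    linarith

theorem inner_add_rho_pos (hP : IsEuclidean P) {x : E} (hx : Dominant b x) {i : ι}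
    (hi : b.IsPos i) : (0 : ℝ) < inner ℝ (x + rho b) (P.root i) := by
  rw [inner_add_left]
  exact add_pos_of_nonneg_of_pos (hx.inner_nonneg hP hi) (inner_rho_root_pos hP hi)

theorem Dominant.eq_of_smul_eq (hP : IsEuclidean P) {x y : E} (hx : Dominant b x)
    (hy : Dominant b y) {w : P.weylGroup} (h : w • x = y) : x = y := by
  rw [← h]
  refine (smul_eq_self_of_nonneg (b := b) hP w (fun i hi => hx.inner_nonneg hP hi)
    fun i hi => ?_).symm
  rw [h]
  exact hy.inner_nonneg hP hi

variable [P.IsRootSystem]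

/-- At a maximum of ⟨ρ, wx⟩ over the finite group, a negative pairing with a simple coroot would let
s_i increase the value. -/
theorem IsWeight.exists_dominant (hP : IsEuclidean P) {x : E} (hx : IsWeight P x) :
    ∃ w : P.weylGroup, Dominant b (w • x) := by
  obtain ⟨w, hw⟩ := Finite.exists_max fun w : P.weylGroup => (inner ℝ (rho b) (w • x) : ℝ)
  refine ⟨w, dominant_of_simple hP (hx.smul hP w) fun i hi => ?_⟩
  have h := hw (weylGroup.ofIdx P i * w)
  have hpos := inner_rho_root_pos hP (Base.isPos_of_mem_support hi)
  rw [mul_smul, ofIdx_smul_eq, inner_sub_right, real_inner_smul_right] at h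
  by_contra! hneg
  nlinarith [mul_pos_of_neg_of_neg hneg (neg_neg_of_pos hpos)]

/-- Dominance is all that is needed later: the determinant of this element matters only when ρ + ν
is regular, and then dominance alone determines the element. -/
theorem IsWeight.dominant_shortestToDominant (hP : IsEuclidean P) {x : E} (hx : IsWeight P x) :
    Dominant b (shortestToDominant b x • x) := by
  have hne : {w : P.weylGroup | Dominant b (w • x)}.Nonempty := hx.exists_dominant hP
  obtain ⟨w, hw, hmin⟩ := Set.exists_min_image _ (weylLength b) (Set.toFinite _) hne
  have : ∃ w, IsShortestToDominant b x w := ⟨w, hw, hmin⟩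
  exact (Classical.epsilon_spec this).1

omit [P.IsRootSystem] in
/-- A dominant weight which is not fixed by any simple reflection is the sum of a dominant weight
and `ρ`. -/
theorem Dominant.sub_rho (hP : IsEuclidean P) {x : E} (hx : Dominant b x)
    (h : ∀ i ∈ b.support, weylGroup.ofIdx P i • x ≠ x) : Dominant b (x - rho b) := by
  refine dominant_of_simple hP ((hx.isWeight hP).sub (isWeight_rho hP)) fun i hi => ?_
  obtain ⟨n, hn⟩ := hx i (mem_posRoots.mpr (Base.isPos_of_mem_support hi))
  rw [map_sub, LinearMap.sub_apply, pairing_rho_simple hi, hn, sub_nonneg]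
  have hn0 : n ≠ 0 := by
    rintro rfl
    refine h i hi ?_
    rw [ofIdx_smul_eq, hn]
    simp
  exact_mod_cast Nat.one_le_iff_ne_zero.mpr hn0

end Orbits

end

section

/-! ## Exponentials -/

section Exponentials

variable {E : Type*} [AddCommGroup E]

theorem exp_add (x y : E) : exp (x + y) = exp x * exp y := by
  simp [exp, AddMonoidAlgebra.single_mul_single]

theorem exp_zero : exp (0 : E) = 1 := rfl

theorem exp_sum {κ : Type*} (s : Finset κ) (f : κ → E) :
    exp (∑ i ∈ s, f i) = ∏ i ∈ s, exp (f i) := by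
  induction s using Finset.induction_on with
  | empty => simp [exp_zero]
  | insert i s hi ih => rw [Finset.sum_insert hi, Finset.prod_insert hi, exp_add, ih]

theorem coeff_exp (x y : E) : (exp x).coeff y = if x = y then 1 else 0 :=
  Finsupp.single_apply

theorem exp_injective : Function.Injective (exp : E → ExpAlg E) :=
  AddMonoidAlgebra.single_left_injective one_ne_zero

theorem tPow_add (a c : ℝ) : tPow (a + c) = tPow a * tPow c := by
  simp [tPow, AddMonoidAlgebra.single_mul_single]

theorem tPow_zero : tPow 0 = 1 := rfl

theorem tPow_sum {κ : Type*} (s : Finset κ) (f : κ → ℝ) :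
    tPow (∑ i ∈ s, f i) = ∏ i ∈ s, tPow (f i) := by
  induction s using Finset.induction_on with
  | empty => simp [tPow_zero]
  | insert i s hi ih => rw [Finset.sum_insert hi, Finset.prod_insert hi, tPow_add, ih]

theorem eq_zero_of_eq_neg {M : Type*} [AddCommGroup M] [Module ℝ M] {x : M} (h : x = -x) :
    x = 0 := by
  have h2 : (2 : ℝ) • x = 0 := by
    rw [two_smul]
    nth_rewrite 1 [h]
    exact neg_add_cancel x
  exact (smul_eq_zero.mp h2).resolve_left two_ne_zero

end Exponentials

variable {ι E N : Type*} [NormedAddCommGroup E] [InnerProductSpace ℝ E]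
  [AddCommGroup N] [Module ℝ N]

/-- The algebra endomorphism `e ^ y ↦ t ^ ⟨y, x⟩ e ^ y`. -/
def tTranslation (x : E) : ExpAlg E →ₐ[QT] ExpAlg E :=
  AddMonoidAlgebra.lift QT (ExpAlg E) E
    { toFun := fun y => tPow (inner ℝ y.toAdd x) • exp y.toAdd
      map_one' := by
        simp [tPow_zero, exp_zero]
      map_mul' := fun y z => by
        simp [tPow_add, exp_add, inner_add_left, mul_comm, smul_smul] }

theorem tTranslation_exp (x y : E) :
    tTranslation x (exp y) = tPow (inner ℝ y x) • exp y := by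
  simp [tTranslation, exp, AddMonoidAlgebra.lift_single]

/-! ## The action of the Weyl group on exponentials -/

section Action

variable {P : RootPairing ι ℝ E N}

/-- The action of the Weyl group on the algebra of exponentials. -/
def weylAct (w : P.weylGroup) : ExpAlg E →ₐ[QT] ExpAlg E :=
  AddMonoidAlgebra.mapDomainAlgHom QT QT (DistribSMul.toAddMonoidHom E w)

theorem weylAct_exp (w : P.weylGroup) (x : E) : weylAct w (exp x) = exp (w • x) := by
  simp [weylAct, exp]

theorem weylAct_mul (w w' : P.weylGroup) (f : ExpAlg E) :
    weylAct (w * w') f = weylAct w (weylAct w' f) := by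
  have : weylAct (w * w') = (weylAct w).comp (weylAct w') := by
    refine AddMonoidAlgebra.algHom_ext (fun x => ?_) (Subsingleton.elim _ _)
    simp [weylAct, mul_smul]
  rw [this, AlgHom.comp_apply]

theorem weylAct_one (f : ExpAlg E) : weylAct (1 : P.weylGroup) f = f := by
  have : weylAct (1 : P.weylGroup) = AlgHom.id QT (ExpAlg E) := by
    refine AddMonoidAlgebra.algHom_ext (fun x => ?_) (Subsingleton.elim _ _)
    simp [weylAct]
  rw [this, AlgHom.id_apply]

theorem coeff_weylAct_smul (w : P.weylGroup) (f : ExpAlg E) (x : E) :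
    (weylAct w f).coeff (w • x) = f.coeff x :=
  Finsupp.mapDomain_apply (MulAction.injective w) f.coeff x

end Action

/-! ## The determinant of a Weyl group element -/

section Determinant

variable {P : RootPairing ι ℝ E N}

theorem weylDet_one : weylDet P 1 = 1 := by simp [weylDet]

theorem weylDet_mul (w w' : P.weylGroup) : weylDet P (w * w') = weylDet P w * weylDet P w' := by
  simp [weylDet]

theorem weylDet_ofIdx [FiniteDimensional ℝ E] (i : ι) :
    weylDet P (weylGroup.ofIdx P i) = -1 := by
  -- The map x ↦ x + f(x) v has determinant 1 + f(v), here with f the coroot and v = -α, so 1 - 2.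
  have h : P.weylGroupRootRep (weylGroup.ofIdx P i)
      = LinearMap.transvection (P.coroot' i) (-P.root i) := by
    ext x
    change weylGroup.ofIdx P i • x = _
    rw [ofIdx_smul_eq, LinearMap.transvection.apply]
    simp [sub_eq_add_neg]
  have h2 : P.coroot' i (-P.root i) = -2 := by
    rw [map_neg, root_coroot'_eq_pairing, pairing_same]
  rw [weylDet, h, LinearMap.transvection.det, h2]
  norm_num

theorem weylDet_mul_self [FiniteDimensional ℝ E] (w : P.weylGroup) :
    weylDet P w * weylDet P w = 1 := by
  obtain ⟨w, hw⟩ := w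
  induction hw using weylGroup.induction with
  | mem i =>
    change weylDet P (weylGroup.ofIdx P i) * weylDet P (weylGroup.ofIdx P i) = 1
    rw [weylDet_ofIdx]
    norm_num
  | one =>
    change weylDet P 1 * weylDet P 1 = 1
    rw [weylDet_one, mul_one]
  | mul g₁ g₂ hg₁ hg₂ h₁ h₂ =>
    rw [← Submonoid.mk_mul_mk _ _ _ hg₁ hg₂, weylDet_mul, mul_mul_mul_comm]
    exact (congrArg₂ (· * ·) h₁ h₂).trans (one_mul 1)

theorem weylDet_inv [FiniteDimensional ℝ E] (w : P.weylGroup) :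
    weylDet P w⁻¹ = weylDet P w := by
  have h : weylDet P w⁻¹ * weylDet P w = 1 := by
    rw [← weylDet_mul, inv_mul_cancel, weylDet_one]
  calc weylDet P w⁻¹ = weylDet P w⁻¹ * (weylDet P w * weylDet P w) := by
        rw [weylDet_mul_self, mul_one]
    _ = weylDet P w := by rw [← mul_assoc, h, one_mul]

/-- The alternating sum `∑_{w ∈ W} det(w) e ^ (w x)`. -/
def altSum (P : RootPairing ι ℝ E N) [P.IsRootSystem] [Fintype ι] (x : E) : ExpAlg E :=
  ∑ w : P.weylGroup, weylDet P w • exp (w • x)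

variable [Fintype ι] [FiniteDimensional ℝ E] [P.IsRootSystem]

theorem altSum_smul (w : P.weylGroup) (x : E) :
    altSum P (w • x) = weylDet P w • altSum P x := by
  rw [altSum, altSum, Finset.smul_sum, ← Equiv.sum_comp (Equiv.mulRight w⁻¹)]
  refine Finset.sum_congr rfl fun u _ => ?_
  have h : (u * w⁻¹) • w • x = u • x := by rw [smul_smul, inv_mul_cancel_right]
  rw [Equiv.coe_mulRight, weylDet_mul, weylDet_inv, mul_comm, mul_smul, h]

theorem altSum_eq_zero_of_fixed {i : ι} {x : E} (h : weylGroup.ofIdx P i • x = x) :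
    altSum P x = 0 := by
  have h' := altSum_smul (weylGroup.ofIdx P i) x
  rw [h, weylDet_ofIdx, neg_smul, one_smul] at h'
  exact eq_zero_of_eq_neg h'

end Determinant

/-! ## The Weyl denominator formula -/

section Denominator

variable [Fintype ι] {P : RootPairing ι ℝ E N} (b : P.Base)

/-- The Weyl denominator as an element of the algebra of exponentials. -/
def denominator : ExpAlg E :=
  ∏ i ∈ posRoots b, (exp ((1 / 2 : ℝ) • P.root i) - exp (-((1 / 2 : ℝ) • P.root i)))

theorem algebraMap_denominator :
    algebraMap (ExpAlg E) (ExpField E) (denominator b) = weylDenominator b := by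
  simp [denominator, weylDenominator, expF]

variable {b}

/-- Here `s` is the set of factors from which e^{α/2} is taken; each of the others lowers the
exponent ρ by a full root. -/
theorem denominator_eq_sum :
    denominator b = ∑ s ∈ (posRoots b).powerset,
      (-1 : ExpAlg E) ^ (posRoots b \ s).card * exp (rho b - ∑ i ∈ posRoots b \ s, P.root i) := by
  simp_rw [denominator, sub_eq_add_neg, Finset.prod_add]
  refine Finset.sum_congr rfl fun s hs => ?_
  have hsub := Finset.mem_powerset.mp hs
  have hrho : rho b - ∑ i ∈ posRoots b \ s, P.root i
      = ∑ i ∈ s, (1 / 2 : ℝ) • P.root i + ∑ i ∈ posRoots b \ s, -((1 / 2 : ℝ) • P.root i) := by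
    rw [rho, ← Finset.sum_sdiff hsub, Finset.sum_neg_distrib, ← Finset.smul_sum,
      ← Finset.smul_sum]
    module
  rw [← sub_eq_add_neg, hrho, exp_add, exp_sum, exp_sum, mul_left_comm]
  congr 1
  exact Finset.prod_neg fun i => exp (-((1 / 2 : ℝ) • P.root i))

theorem coeff_denominator (x : E) :
    (denominator b).coeff x = ∑ s ∈ (posRoots b).powerset,
      if rho b - ∑ i ∈ posRoots b \ s, P.root i = x
        then (-1 : QT) ^ (posRoots b \ s).card else 0 := by
  rw [denominator_eq_sum, AddMonoidAlgebra.coeff_sum, Finsupp.finsetSum_apply]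
  refine Finset.sum_congr rfl fun s _ => ?_
  have h : ((-1 : ExpAlg E) ^ (posRoots b \ s).card) = algebraMap QT (ExpAlg E)
      ((-1) ^ (posRoots b \ s).card) := by
    rw [map_pow, map_neg, map_one]
  rw [h, ← Algebra.smul_def, AddMonoidAlgebra.coeff_smul_apply, coeff_exp]
  simp

theorem sub_mem_posCone_of_coeff_denominator_ne_zero {x : E}
    (h : (denominator b).coeff x ≠ 0) : rho b - x ∈ posCone b := by
  rw [coeff_denominator] at h
  obtain ⟨s, -, hs⟩ := Finset.exists_ne_zero_of_sum_ne_zero h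
  have hx := (ite_ne_right_iff.mp hs).1
  rw [← hx, sub_sub_cancel]
  exact sum_mem fun i hi => root_mem_posCone (mem_posRoots.mp (Finset.mem_sdiff.mp hi).1)

variable [P.IsCrystallographic] [P.IsReduced]

theorem coeff_denominator_rho (hP : IsEuclidean P) : (denominator b).coeff (rho b) = 1 := by
  rw [coeff_denominator, Finset.sum_eq_single (posRoots b)]
  · simp
  · intro s hs hne
    refine if_neg fun h => hne ?_
    have hzero : ∑ i ∈ posRoots b \ s, P.root i = 0 := by simpa using h
    refine Finset.Subset.antisymm (Finset.mem_powerset.mp hs) fun i hi => ?_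
    by_contra his
    have hpos : (0 : ℝ) < inner ℝ (rho b) (∑ i ∈ posRoots b \ s, P.root i) := by
      rw [inner_sum]
      exact Finset.sum_pos
        (fun j hj => inner_rho_root_pos hP (mem_posRoots.mp (Finset.mem_sdiff.mp hj).1))
        ⟨i, Finset.mem_sdiff.mpr ⟨hi, his⟩⟩
    rw [hzero, inner_zero_right] at hpos
    exact lt_irrefl _ hpos
  · simp

/-- The factor of α_i changes sign, and the remaining factors are permuted. -/
theorem weylAct_ofIdx_denominator {i : ι} (hi : i ∈ b.support) :
    weylAct (weylGroup.ofIdx P i) (denominator b) = -denominator b := by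
  have hmem : i ∈ posRoots b := mem_posRoots.mpr (Base.isPos_of_mem_support hi)
  have h := prod_posRoots_erase_reflectionPerm (b := b)
    (fun j => exp ((1 / 2 : ℝ) • P.root j) - exp (-((1 / 2 : ℝ) • P.root j))) hi
  rw [denominator, ← Finset.mul_prod_erase _ _ hmem, map_mul, map_prod]
  simp_rw [map_sub, weylAct_exp, smul_neg, weyl_smul_smul, ofIdx_smul_root,
    P.weylGroup_apply_root]
  rw [h, smul_neg, neg_neg]
  ring

variable [FiniteDimensional ℝ E]

theorem weylAct_denominator (hP : IsEuclidean P) (w : P.weylGroup) :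
    weylAct w (denominator b) = weylDet P w • denominator b := by
  induction w using weylGroup_induction (b := b) hP with
  | one => rw [weylAct_one, weylDet_one, one_smul]
  | step w i _ ih =>
    rw [weylAct_mul, weylAct_ofIdx_denominator i.2, map_neg, weylDet_mul, weylDet_ofIdx, mul_neg,
      mul_one, neg_smul, neg_inj] at ih
    exact ih

theorem coeff_denominator_smul (hP : IsEuclidean P) (w : P.weylGroup) (x : E) :
    (denominator b).coeff (w • x) = weylDet P w • (denominator b).coeff x := by
  rw [← coeff_weylAct_smul w (denominator b) x, weylAct_denominator hP,
    AddMonoidAlgebra.coeff_smul_apply, smul_smul, weylDet_mul_self, one_smul]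

variable [P.IsRootSystem]

/-- By antisymmetry the coefficient is also nonzero at a dominant conjugate wx, and no simple
reflection fixes wx. So wx - ρ is dominant while ρ - wx lies in the positive cone, which forces wx =
ρ. -/
theorem exists_smul_rho_of_coeff_denominator_ne_zero (hP : IsEuclidean P) {x : E}
    (h : (denominator b).coeff x ≠ 0) : ∃ w : P.weylGroup, w • rho b = x := by
  have hx : IsWeight P x := by
    have hcone : ∀ z ∈ posCone b, IsWeight P z := by
      intro z hz
      induction hz using AddSubmonoid.closure_induction with
      | mem z hz =>
        obtain ⟨i, -, rfl⟩ := hz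
        exact isWeight_root i
      | zero => exact fun i => ⟨0, by simp⟩
      | add y z _ _ hy hz => exact hy.add hz
    have := (isWeight_rho (b := b) hP).sub
      (hcone _ (sub_mem_posCone_of_coeff_denominator_ne_zero h))
    rwa [sub_sub_cancel] at this
  obtain ⟨w, hw⟩ := hx.exists_dominant (b := b) hP
  have hwx : (denominator b).coeff (w • x) ≠ 0 := fun h0 => h <| by
    have := coeff_denominator_smul (b := b) hP w⁻¹ (w • x)
    rwa [inv_smul_smul, h0, smul_zero] at this
  have hdom : Dominant b (w • x - rho b) := hw.sub_rho hP fun i _ hfix => hwx <| by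
    have h1 := coeff_denominator_smul (b := b) hP (weylGroup.ofIdx P i) (w • x)
    rw [hfix, weylDet_ofIdx, neg_smul, one_smul] at h1
    exact eq_zero_of_eq_neg h1
  -- The nonnegative pairing of wx - ρ with ρ - wx is minus a squared norm.
  have hin := inner_nonneg_of_mem_posCone (fun i hi => hdom.inner_nonneg hP hi)
    (sub_mem_posCone_of_coeff_denominator_ne_zero hwx)
  rw [← neg_sub (rho b), inner_neg_left, neg_nonneg] at hin
  have hzero := inner_self_eq_zero.mp (le_antisymm hin real_inner_self_nonneg)
  exact ⟨w⁻¹, by rw [sub_eq_zero.mp hzero, inv_smul_smul]⟩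

/-- The Weyl denominator formula. -/
theorem denominator_eq_altSum (hP : IsEuclidean P) : denominator b = altSum P (rho b) := by
  refine AddMonoidAlgebra.ext (Finsupp.ext fun x => ?_)
  rw [altSum, AddMonoidAlgebra.coeff_sum, Finsupp.finsetSum_apply]
  simp_rw [AddMonoidAlgebra.coeff_smul_apply, coeff_exp]
  by_cases hx : ∃ w : P.weylGroup, w • rho b = x
  · obtain ⟨w, rfl⟩ := hx
    rw [coeff_denominator_smul hP, coeff_denominator_rho hP,
      Finset.sum_eq_single_of_mem w (Finset.mem_univ w)]
    · simp
    · intro u _ hu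
      rw [if_neg, smul_zero]
      intro h
      refine hu (inv_mul_eq_one.mp (eq_one_of_smul_eq (b := b) hP (x := rho b)
        (fun i hi => inner_rho_root_pos hP hi) ?_)).symm
      rw [mul_smul, h, inv_smul_smul]
  · rw [Finset.sum_eq_zero]
    · by_contra h
      exact hx (exists_smul_rho_of_coeff_denominator_ne_zero hP h)
    · intro w _
      rw [if_neg fun h => hx ⟨w, h⟩, smul_zero]

end Denominator

end

section

variable {ι E N : Type*} [Fintype ι] [NormedAddCommGroup E] [InnerProductSpace ℝ E]
  [AddCommGroup N] [Module ℝ N]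

/-! ## Sums over orbits -/

section OrbitSums

variable {P : RootPairing ι ℝ E N} [P.IsRootSystem]

theorem mem_weylOrbit {x y : E} : y ∈ weylOrbit P x ↔ ∃ w : P.weylGroup, w • x = y := by
  simp [weylOrbit]

theorem self_mem_weylOrbit (x : E) : x ∈ weylOrbit P x := mem_weylOrbit.mpr ⟨1, one_smul _ x⟩

theorem sum_weylOrbit_smul {M : Type*} [AddCommMonoid M] (x : E) (w : P.weylGroup) (f : E → M) :
    ∑ y ∈ weylOrbit P x, f (w • y) = ∑ y ∈ weylOrbit P x, f y := by
  refine Finset.sum_bij' (fun y _ => w • y) (fun y _ => w⁻¹ • y) ?_ ?_ ?_ ?_ ?_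
  · intro y hy
    obtain ⟨u, rfl⟩ := mem_weylOrbit.mp hy
    exact mem_weylOrbit.mpr ⟨w * u, mul_smul _ _ _⟩
  · intro y hy
    obtain ⟨u, rfl⟩ := mem_weylOrbit.mp hy
    exact mem_weylOrbit.mpr ⟨w⁻¹ * u, mul_smul _ _ _⟩
  · intro y _
    exact inv_smul_smul w y
  · intro y _
    exact smul_inv_smul w y
  · intro y _
    rfl

theorem sum_weylGroup_smul {M : Type*} [AddCommMonoid M] (x : E) (f : E → M) :
    ∑ w : P.weylGroup, f (w • x) = stabilizerCard P x • ∑ y ∈ weylOrbit P x, f y := by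
  rw [Finset.sum_comp f fun w : P.weylGroup => w • x, Finset.smul_sum]
  refine Finset.sum_congr rfl fun y hy => ?_
  obtain ⟨u, rfl⟩ := mem_weylOrbit.mp hy
  congr 1
  rw [stabilizerCard, Nat.card_eq_fintype_card, Fintype.card_subtype]
  -- The fibre over ux is the coset of the stabilizer through u.
  refine Finset.card_equiv (Equiv.mulLeft u⁻¹) fun w => ?_
  simp only [Finset.mem_filter, Finset.mem_univ, true_and, Equiv.coe_mulLeft,
    MulAction.mem_stabilizer_iff, mul_smul, inv_smul_eq_iff]

end OrbitSums

/-! ## Passing to the field of fractions -/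

section Fractions

omit [InnerProductSpace ℝ E] in
theorem algebraMap_real_smul (c : ℝ) (f : ExpAlg E) :
    algebraMap (ExpAlg E) (ExpField E) (c • f) = c • algebraMap (ExpAlg E) (ExpField E) f :=
  map_smul (IsScalarTower.toAlgHom ℝ (ExpAlg E) (ExpField E)) c f

omit [InnerProductSpace ℝ E] in
theorem algebraMap_qt_smul (c : QT) (f : ExpAlg E) :
    algebraMap (ExpAlg E) (ExpField E) (c • f) = c • algebraMap (ExpAlg E) (ExpField E) f :=
  map_smul (IsScalarTower.toAlgHom QT (ExpAlg E) (ExpField E)) c f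

omit [InnerProductSpace ℝ E] in
theorem coeffF_mul_eq_smul (c : QT) (f : ExpField E) : coeffF E c * f = c • f :=
  (Algebra.smul_def c f).symm

omit [InnerProductSpace ℝ E] in
theorem expF_add (x y : E) : expF (x + y) = expF x * expF y := by
  rw [expF, exp_add, map_mul]
  rfl

omit [InnerProductSpace ℝ E] in
theorem expF_injective : Function.Injective (expF : E → ExpField E) :=
  (IsFractionRing.injective (ExpAlg E) (ExpField E)).comp exp_injective

omit [InnerProductSpace ℝ E] in
theorem expF_neg_mul (x : E) : expF (-x) * expF x = 1 := by
  rw [← expF_add, neg_add_cancel, expF, exp_zero, map_one]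

variable {P : RootPairing ι ℝ E N} (b : P.Base)

theorem weylDenominator_ne_zero : weylDenominator b ≠ 0 := by
  refine Finset.prod_ne_zero_iff.mpr fun i _ => sub_ne_zero.mpr fun h => P.ne_zero i ?_
  have h' := expF_injective h
  rw [eq_neg_iff_add_eq_zero, ← add_smul] at h'
  norm_num at h'
  exact h'

theorem weylChar_eq [P.IsRootSystem] (x : E) :
    weylChar b x = (weylDenominator b)⁻¹ *
      algebraMap (ExpAlg E) (ExpField E) (altSum P (x + rho b)) := by
  rw [weylChar, altSum, map_sum]
  simp_rw [algebraMap_real_smul]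
  rfl

theorem macdonaldOp_apply [P.IsRootSystem] (ϖ : E) (f : ExpAlg E) :
    macdonaldOp b ϖ f = (stabilizerCard P ϖ : ExpField E)⁻¹ * ∑ w : P.weylGroup,
      macdonaldCoeff b ϖ w * algebraMap (ExpAlg E) (ExpField E) (qTranslation (w • ϖ) f) := by
  rw [macdonaldOp, LinearMap.smul_apply, LinearMap.sum_apply, smul_eq_mul]
  rfl

end Fractions

/-! ## The coefficients of the Macdonald operator -/

section Coefficients

variable {P : RootPairing ι ℝ E N} {b : P.Base}

omit [Fintype ι] in
-- With X = e^{wα/2} and T = t^{⟨ϖ,α⟩/2}, this is (1 - T²X²)/(1 - X²) · (X - X⁻¹) = T (TX - T⁻¹X⁻¹).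
theorem macdonaldFactor_mul (ϖ : E) (w : P.weylGroup) (i : ι) :
    (1 - coeffF E (tPow (inner ℝ ϖ (P.root i))) * expF (w • P.root i)) /
        (1 - expF (w • P.root i)) *
      algebraMap (ExpAlg E) (ExpField E)
        (weylAct w (exp ((1 / 2 : ℝ) • P.root i) - exp (-((1 / 2 : ℝ) • P.root i)))) =
    coeffF E (tPow (inner ℝ ϖ ((1 / 2 : ℝ) • P.root i))) *
      algebraMap (ExpAlg E) (ExpField E) (weylAct w (tTranslation ϖ
        (exp ((1 / 2 : ℝ) • P.root i) - exp (-((1 / 2 : ℝ) • P.root i))))) := by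
  set h : E := (1 / 2 : ℝ) • P.root i with hh
  have hroot : P.root i = h + h := by rw [hh, ← add_smul]; norm_num
  have hne : (1 : ExpField E) - expF (w • P.root i) ≠ 0 := by
    refine sub_ne_zero.mpr fun h1 => P.ne_zero i ?_
    have h0 : expF (0 : E) = (1 : ExpField E) := by rw [expF, exp_zero, map_one]
    rw [← h0] at h1
    have := expF_injective h1
    rwa [eq_comm, smul_eq_zero_iff_eq] at this
  have hT : coeffF E (tPow (inner ℝ ϖ h)) * coeffF E (tPow (inner ℝ (-h) ϖ)) = 1 := by
    rw [coeffF, coeffF, ← map_mul, ← tPow_add, inner_neg_left, real_inner_comm,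
      add_neg_cancel, tPow_zero, map_one]
  have hT2 : coeffF E (tPow (inner ℝ ϖ (P.root i)))
      = coeffF E (tPow (inner ℝ ϖ h)) * coeffF E (tPow (inner ℝ ϖ h)) := by
    rw [coeffF, coeffF, ← map_mul, ← tPow_add, hroot, inner_add_right]
  have hX2 : (expF (w • P.root i) : ExpField E) = expF (w • h) * expF (w • h) := by
    rw [← expF_add, ← smul_add, ← hroot]
  have hXY : (expF (w • -h) : ExpField E) * expF (w • h) = 1 := by
    rw [smul_neg, expF_neg_mul]
  simp only [map_sub, tTranslation_exp, map_smul, weylAct_exp, algebraMap_qt_smul]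
  simp only [← coeffF_mul_eq_smul]
  change _ / _ * (expF (w • h) - expF (w • -h)) = _ *
    (coeffF E (tPow (inner ℝ h ϖ)) * expF (w • h)
      - coeffF E (tPow (inner ℝ (-h) ϖ)) * expF (w • -h))
  rw [div_mul_eq_mul_div, div_eq_iff hne, real_inner_comm ϖ h, hT2, hX2]
  set T := coeffF E (tPow (inner ℝ ϖ h))
  set T' := coeffF E (tPow (inner ℝ (-h) ϖ))
  set X : ExpField E := expF (w • h)
  set Y : ExpField E := expF (w • -h)
  linear_combination (T * T * X - X) * hXY + (Y - Y * X * X) * hT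

variable [P.IsCrystallographic] [P.IsReduced] [FiniteDimensional ℝ E]

theorem macdonaldCoeff_mul (hP : IsEuclidean P) (ϖ : E) (w : P.weylGroup) :
    macdonaldCoeff b ϖ w * weylDenominator b =
      tPow (inner ℝ ϖ (rho b)) • algebraMap (ExpAlg E) (ExpField E)
        (weylDet P w • weylAct w (tTranslation ϖ (denominator b))) := by
  have h : macdonaldCoeff b ϖ w *
        algebraMap (ExpAlg E) (ExpField E) (weylAct w (denominator b)) =
      tPow (inner ℝ ϖ (rho b)) • algebraMap (ExpAlg E) (ExpField E)
        (weylAct w (tTranslation ϖ (denominator b))) := by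
    rw [← coeffF_mul_eq_smul, rho, Finset.smul_sum, inner_sum, tPow_sum, coeffF, macdonaldCoeff,
      denominator]
    simp only [map_prod]
    rw [← Finset.prod_mul_distrib, ← Finset.prod_mul_distrib]
    exact Finset.prod_congr rfl fun i _ => macdonaldFactor_mul ϖ w i
  rw [weylAct_denominator hP, algebraMap_real_smul, algebraMap_denominator,
    mul_smul_comm] at h
  rw [algebraMap_real_smul, smul_comm, ← h, smul_smul, weylDet_mul_self, one_smul]

variable [P.IsRootSystem]

theorem weylDet_smul_weylAct_tTranslation_denominator (hP : IsEuclidean P) (ϖ : E)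
    (w : P.weylGroup) :
    weylDet P w • weylAct w (tTranslation ϖ (denominator b)) =
      ∑ v : P.weylGroup, weylDet P v •
        tPow (inner ℝ (v • rho b) (w • ϖ)) • exp (v • rho b) := by
  rw [denominator_eq_altSum hP, altSum, map_sum, map_sum, Finset.smul_sum]
  -- With v = wu, det(w) det(u) = det(v) and ⟨uρ, ϖ⟩ = ⟨vρ, wϖ⟩.
  refine Fintype.sum_equiv (Equiv.mulLeft w) _ _ fun u => ?_
  rw [AlgHom.map_smul_of_tower, AlgHom.map_smul_of_tower, tTranslation_exp, map_smul,
    weylAct_exp, smul_smul, ← weylDet_mul, Equiv.coe_mulLeft, mul_smul, hP.inner_smul_smul]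

theorem sum_weylAct_mul_qTranslation (hP : IsEuclidean P) (ϖ x : E) :
    ∑ w : P.weylGroup, weylDet P w • weylAct w (tTranslation ϖ (denominator b)) *
        qTranslation (w • ϖ) (monomialSymm P x) =
      stabilizerCard P ϖ • ∑ ν ∈ weylOrbit P x,
        (∑ τ ∈ weylOrbit P ϖ, tPow (inner ℝ τ (rho b)) * qPow (inner ℝ τ ν)) •
          altSum P (ν + rho b) := by
  have hterm : ∀ v w : P.weylGroup,
      (weylDet P v • tPow (inner ℝ (v • rho b) ((v * w) • ϖ)) • exp (v • rho b)) *
        qTranslation ((v * w) • ϖ) (monomialSymm P x) =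
      ∑ ν ∈ weylOrbit P x,
        (tPow (inner ℝ (w • ϖ) (rho b)) * qPow (inner ℝ (w • ϖ) ν)) •
          weylDet P v • exp (v • (ν + rho b)) := by
    intro v w
    rw [monomialSymm, map_sum,
      ← sum_weylOrbit_smul x v fun y => qTranslation ((v * w) • ϖ) (exp y), Finset.mul_sum]
    refine Finset.sum_congr rfl fun ν _ => ?_
    rw [qTranslation_exp, mul_smul, hP.inner_smul_smul, hP.inner_smul_smul,
      real_inner_comm, real_inner_comm (w • ϖ) ν, smul_add, exp_add, smul_comm (weylDet P v),
      smul_mul_smul_comm, smul_mul_assoc, mul_comm (exp (v • ν))]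
  simp_rw [weylDet_smul_weylAct_tTranslation_denominator hP, Finset.sum_mul]
  rw [Finset.sum_comm]
  have hshift : ∀ v : P.weylGroup,
      ∑ w : P.weylGroup,
        (weylDet P v • tPow (inner ℝ (v • rho b) (w • ϖ)) • exp (v • rho b)) *
          qTranslation (w • ϖ) (monomialSymm P x) =
      ∑ w : P.weylGroup, ∑ ν ∈ weylOrbit P x,
        (tPow (inner ℝ (w • ϖ) (rho b)) * qPow (inner ℝ (w • ϖ) ν)) •
          weylDet P v • exp (v • (ν + rho b)) := by
    intro v
    -- Replacing w by vw, together with ν by vν in `hterm`, frees the powers of q and t from v.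
    rw [← Equiv.sum_comp (Equiv.mulLeft v)]
    exact Finset.sum_congr rfl fun w _ => hterm v w
  simp_rw [hshift]
  rw [Finset.sum_comm]
  have hcollect : ∀ w : P.weylGroup,
      ∑ v : P.weylGroup, ∑ ν ∈ weylOrbit P x,
        (tPow (inner ℝ (w • ϖ) (rho b)) * qPow (inner ℝ (w • ϖ) ν)) •
          weylDet P v • exp (v • (ν + rho b)) =
      ∑ ν ∈ weylOrbit P x,
        (tPow (inner ℝ (w • ϖ) (rho b)) * qPow (inner ℝ (w • ϖ) ν)) •
          altSum P (ν + rho b) := by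
    intro w
    rw [Finset.sum_comm]
    simp_rw [altSum, Finset.smul_sum]
  simp_rw [hcollect]
  rw [sum_weylGroup_smul ϖ fun τ => ∑ ν ∈ weylOrbit P x,
    (tPow (inner ℝ τ (rho b)) * qPow (inner ℝ τ ν)) • altSum P (ν + rho b), Finset.sum_comm]
  simp_rw [Finset.sum_smul]

/-- The Macdonald operator applied to a monomial symmetric function, in terms of Weyl
characters. -/
theorem macdonaldOp_monomialSymm (hP : IsEuclidean P) (ϖ x : E) :
    macdonaldOp b ϖ (monomialSymm P x) =
      tPow (inner ℝ ϖ (rho b)) • ∑ ν ∈ weylOrbit P x,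
        (∑ τ ∈ weylOrbit P ϖ, tPow (inner ℝ τ (rho b)) * qPow (inner ℝ τ ν)) •
          weylChar b ν := by
  have hδ := weylDenominator_ne_zero b
  have hcard : (stabilizerCard P ϖ : ExpField E) ≠ 0 := by
    have : CharZero (ExpField E) := algebraRat.charZero _
    exact Nat.cast_ne_zero.mpr Nat.card_pos.ne'
  have hcoeff : ∀ w : P.weylGroup, macdonaldCoeff b ϖ w =
      tPow (inner ℝ ϖ (rho b)) • (algebraMap (ExpAlg E) (ExpField E)
        (weylDet P w • weylAct w (tTranslation ϖ (denominator b))) *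
          (weylDenominator b)⁻¹) := fun w => by
    rw [← smul_mul_assoc, ← macdonaldCoeff_mul hP, mul_inv_cancel_right₀ hδ]
  have key := congrArg (algebraMap (ExpAlg E) (ExpField E))
    (sum_weylAct_mul_qTranslation (b := b) hP ϖ x)
  rw [macdonaldOp_apply]
  simp_rw [hcoeff, weylChar_eq]
  simp only [map_sum, map_mul, map_nsmul, algebraMap_qt_smul] at key
  have hsum : ∑ w : P.weylGroup, tPow (inner ℝ ϖ (rho b)) • (algebraMap (ExpAlg E) (ExpField E)
        (weylDet P w • weylAct w (tTranslation ϖ (denominator b))) * (weylDenominator b)⁻¹) *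
          algebraMap (ExpAlg E) (ExpField E) (qTranslation (w • ϖ) (monomialSymm P x)) =
      tPow (inner ℝ ϖ (rho b)) • ((weylDenominator b)⁻¹ * ∑ w : P.weylGroup,
        algebraMap (ExpAlg E) (ExpField E)
          (weylDet P w • weylAct w (tTranslation ϖ (denominator b))) *
            algebraMap (ExpAlg E) (ExpField E) (qTranslation (w • ϖ) (monomialSymm P x))) := by
    rw [Finset.mul_sum, Finset.smul_sum]
    refine Finset.sum_congr rfl fun w _ => ?_
    rw [smul_mul_assoc, mul_right_comm, mul_comm]
  rw [hsum, key, mul_smul_comm, nsmul_eq_mul, mul_left_comm (weylDenominator b)⁻¹,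
    inv_mul_cancel_left₀ hcard, Finset.mul_sum]
  simp_rw [mul_smul_comm]

end Coefficients

end

section

variable {ι E N : Type*} [Fintype ι] [NormedAddCommGroup E] [InnerProductSpace ℝ E]
  [AddCommGroup N] [Module ℝ N]

/-! ## Expansion in Weyl characters of dominant weights -/

section Dominance

variable {P : RootPairing ι ℝ E N} {b : P.Base}
  [P.IsCrystallographic] [P.IsReduced] [P.IsRootSystem]

omit [P.IsCrystallographic] [P.IsReduced] in
theorem mem_image_sub_rho {μ ν : E} :
    ν ∈ (weylOrbit P (μ + rho b)).image (fun z => z - rho b) ↔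
      ∃ u : P.weylGroup, u • (μ + rho b) = rho b + ν := by
  simp [weylOrbit, sub_eq_iff_eq_add, add_comm (rho b) ν]

theorem smul_add_rho_eq_of_dominant (hP : IsEuclidean P) {μ ν : E} (hμ : Dominant b μ)
    (h : ν ∈ (weylOrbit P (μ + rho b)).image (fun z => z - rho b)) {w : P.weylGroup}
    (hw : Dominant b (w • (rho b + ν))) : w • (rho b + ν) = μ + rho b := by
  obtain ⟨u, hu⟩ := mem_image_sub_rho.mp h
  refine ((hμ.add (dominant_rho hP)).eq_of_smul_eq hP hw (w := w * u) ?_).symm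
  rw [mul_smul, hu]

/-- Ensures that splitting off the leading term ν = λ removes nothing from the lower coefficients.
-/
theorem notMem_image_sub_rho_self (hP : IsEuclidean P) {lam μ : E} (hlam : Dominant b lam)
    (hμ : Dominant b μ) (hne : μ ≠ lam) :
    lam ∉ (weylOrbit P (μ + rho b)).image (fun z => z - rho b) := by
  intro h
  have h1 := smul_add_rho_eq_of_dominant hP hμ h (w := 1)
    (by rw [one_smul]; exact (dominant_rho hP).add hlam)
  rw [one_smul, add_comm, add_left_inj] at h1
  exact hne h1.symm

theorem prec_smul_add_rho_sub_rho (hP : IsEuclidean P) {lam ν : E} (hlam : Dominant b lam)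
    (hν : ν ∈ weylOrbit P lam) (hne : ν ≠ lam) (w : P.weylGroup) :
    Prec b (w • (rho b + ν) - rho b) lam := by
  obtain ⟨u, rfl⟩ := mem_weylOrbit.mp hν
  have h1 := hlam.sub_smul_mem_posCone hP (w * u)
  have h2 := (dominant_rho (b := b) hP).sub_smul_mem_posCone hP w
  have hsum : lam - (w • (rho b + u • lam) - rho b)
      = (lam - (w * u) • lam) + (rho b - w • rho b) := by
    rw [smul_add, mul_smul]
    abel
  refine ⟨hsum ▸ add_mem h1 h2, fun h => hne ?_⟩
  rw [h, sub_self] at hsum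
  obtain ⟨h3, h4⟩ := eq_zero_of_add_eq_zero hP h1 h2 hsum.symm
  have hw : w = 1 := eq_one_of_smul_eq (b := b) hP (fun i hi => inner_rho_root_pos hP hi)
    (sub_eq_zero.mp h4).symm
  rw [hw, one_mul] at h3
  exact (sub_eq_zero.mp h3).symm

variable [FiniteDimensional ℝ E]

omit [P.IsCrystallographic] [P.IsReduced] in
theorem weylChar_eq_weylDet_smul (w : P.weylGroup) (ν : E) :
    weylChar b ν = weylDet P w • weylChar b (w • (rho b + ν) - rho b) := by
  rw [weylChar_eq, weylChar_eq, sub_add_cancel, altSum_smul, algebraMap_real_smul, mul_smul_comm,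
    smul_smul, weylDet_mul_self, one_smul, add_comm]

/-- At most one summand survives, the one with μ + ρ the dominant conjugate of ρ + ν; if that
conjugate is singular, both sides vanish. -/
theorem weylChar_eq_sum (hP : IsEuclidean P) {lam ν : E} (hlam : Dominant b lam)
    (hν : ν ∈ weylOrbit P lam) (hne : ν ≠ lam) (s : Finset E)
    (hs : ∀ μ, μ ∈ s ↔ Dominant b μ ∧ Prec b μ lam) :
    weylChar b ν = ∑ μ ∈ s,
      if ν ∈ (weylOrbit P (μ + rho b)).image (fun z => z - rho b)
        then weylDet P (shortestToDominant b (rho b + ν)) • weylChar b μ else 0 := by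
  have hweight : IsWeight P (rho b + ν) := by
    obtain ⟨u, rfl⟩ := mem_weylOrbit.mp hν
    exact (isWeight_rho hP).add ((hlam.isWeight hP).smul hP u)
  have hdom := hweight.dominant_shortestToDominant (b := b) hP
  set w := shortestToDominant b (rho b + ν)
  by_cases hfix : ∃ i ∈ b.support, weylGroup.ofIdx P i • w • (rho b + ν) = w • (rho b + ν)
  · obtain ⟨i, hi, hfix⟩ := hfix
    rw [Finset.sum_eq_zero, weylChar_eq_weylDet_smul w, weylChar_eq, sub_add_cancel,
      altSum_eq_zero_of_fixed hfix, map_zero, mul_zero, smul_zero]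
    intro μ hμ
    refine if_neg fun hmem => ?_
    have hμdom := ((hs μ).mp hμ).1
    -- Otherwise s_i would fix the regular vector μ + ρ and be the identity, although its
    -- determinant is -1.
    rw [smul_add_rho_eq_of_dominant hP hμdom hmem hdom] at hfix
    have hone := eq_one_of_smul_eq (b := b) hP (fun j hj => inner_add_rho_pos hP hμdom hj) hfix
    have hdet := weylDet_ofIdx (P := P) i
    rw [hone, weylDet_one] at hdet
    norm_num at hdet
  · push Not at hfix
    have hμ₀ := hdom.sub_rho hP hfix
    have hmem : w • (rho b + ν) - rho b ∈ s :=
      (hs _).mpr ⟨hμ₀, prec_smul_add_rho_sub_rho hP hlam hν hne w⟩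
    rw [Finset.sum_eq_single_of_mem _ hmem, if_pos]
    · exact weylChar_eq_weylDet_smul w ν
    · exact mem_image_sub_rho.mpr ⟨w⁻¹, by rw [sub_add_cancel, inv_smul_smul]⟩
    · intro μ hμ hμne
      refine if_neg fun hmem' => hμne ?_
      rw [smul_add_rho_eq_of_dominant hP ((hs μ).mp hμ).1 hmem' hdom, add_sub_cancel_right]

theorem sum_eigenvalue_smul_weylChar (hP : IsEuclidean P) (ϖ : E) {lam : E}
    (hlam : Dominant b lam) (s : Finset E) (hs : ∀ μ, μ ∈ s ↔ Dominant b μ ∧ Prec b μ lam) :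
    ∑ ν ∈ weylOrbit P lam, eigenvalue b ϖ ν • weylChar b ν =
      eigenvalue b ϖ lam • weylChar b lam +
        ∑ μ ∈ s, matrixCoeff b ϖ lam μ • weylChar b μ := by
  rw [← Finset.add_sum_erase _ _ (self_mem_weylOrbit (P := P) lam)]
  congr 1
  have hexp : ∀ ν ∈ (weylOrbit P lam).erase lam, eigenvalue b ϖ ν • weylChar b ν =
      ∑ μ ∈ s, if ν ∈ (weylOrbit P (μ + rho b)).image (fun z => z - rho b)
        then (weylDet P (shortestToDominant b (rho b + ν)) • eigenvalue b ϖ ν) • weylChar b μ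
        else 0 := by
    intro ν hν
    obtain ⟨hne, hν⟩ := Finset.mem_erase.mp hν
    rw [weylChar_eq_sum hP hlam hν hne s hs, Finset.smul_sum]
    refine Finset.sum_congr rfl fun μ _ => ?_
    split_ifs
    · rw [smul_comm, smul_assoc]
    · exact smul_zero _
  rw [Finset.sum_congr rfl hexp, Finset.sum_comm]
  refine Finset.sum_congr rfl fun μ hμ => ?_
  obtain ⟨hdom, -, hne⟩ := (hs μ).mp hμ
  rw [matrixCoeff, Finset.sum_smul, Finset.sum_ite_mem, Finset.erase_inter,
    Finset.erase_eq_of_notMem]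
  exact fun h => notMem_image_sub_rho_self hP hlam hdom hne (Finset.mem_inter.mp h).2

end Dominance

end

end Macdonald

end

theorem proposition6p2 {ι E N : Type*} [Fintype ι]
    [NormedAddCommGroup E] [InnerProductSpace ℝ E] [FiniteDimensional ℝ E]
    [AddCommGroup N] [Module ℝ N]
    (P : RootPairing ι ℝ E N) [P.IsRootSystem] [P.IsCrystallographic] [P.IsReduced]
    [P.IsIrreducible] (hP : Macdonald.IsEuclidean P) (b : P.Base)
    (ϖ : E) (hϖ : Macdonald.IsMinuscule b ϖ)
    (lam : E) (hlam : Macdonald.Dominant b lam) :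
    (Macdonald.macdonaldOp b ϖ (Macdonald.monomialSymm P lam) =
      Macdonald.tPow (inner ℝ ϖ (Macdonald.rho b)) •
        ∑ ν ∈ Macdonald.weylOrbit P lam,
          (∑ τ ∈ Macdonald.weylOrbit P ϖ,
            Macdonald.tPow (inner ℝ τ (Macdonald.rho b)) * Macdonald.qPow (inner ℝ τ ν)) •
              Macdonald.weylChar b ν) ∧
    ∃ hfin : {mu : E | Macdonald.Dominant b mu ∧ Macdonald.Prec b mu lam}.Finite,
      Macdonald.macdonaldOp b ϖ (Macdonald.monomialSymm P lam) =
        Macdonald.eigenvalue b ϖ lam • Macdonald.weylChar b lam +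
          ∑ mu ∈ hfin.toFinset,
            Macdonald.matrixCoeff b ϖ lam mu • Macdonald.weylChar b mu :=
  ⟨Macdonald.macdonaldOp_monomialSymm hP ϖ lam, Macdonald.finite_dominant_prec hP lam, by
    rw [Macdonald.macdonaldOp_monomialSymm hP ϖ lam, Finset.smul_sum,
      ← Macdonald.sum_eigenvalue_smul_weylChar hP ϖ hlam _
        fun _ => (Set.Finite.mem_toFinset _).trans Iff.rfl]
    simp_rw [smul_smul]
    rfl⟩
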